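/- Let $n\ge 1$ and let $(G_k)_{k\ge 0}$ be an arbitrary sequence of connected undirected simple graphs on the vertex set $V=\{1,\dots,n\}$; put $\mathcal G(t)=G_{\lfloor t\rfloor}$ for $t\ge 0$. Let $d_i(t)$ be the degree of $i$ in $\mathcal G(t)$. For every edge $\{i,j\}$ of $\mathcal G(t)$ let $\lambda_{ij}(t)=1/\max\{d_i(t),d_j(t)\}$, let $\lambda_{ij}(t)=0$ if $i\ne j$ and $\{i,j\}$ is not an edge of $\mathcal G(t)$, and let $\lambda_{ii}(t)=1-\frac12\sum_{j\ne i}\lambda_{ij}(t)$ be the rate of a self-loop at $i$. To every unordered pair $\{i,j\}$ (with $i=j$ allowed) attach a Poisson process with rate $\lambda_{ij}(t)$ at time $t$, all these processes being independent. Each node $i$ holds an integer value $x_i(t)$, with deterministic initial value $x_i(0)\in[l,L]$, where $l,L$ are integers. The values change only when a process registers an arrival: at an arrival of $\{i,j\}$ with $i\ne j$ the value $x_i$ is replaced by $x_i-1$ if $x_i>x_j$, by $x_i+1$ if $x_i<x_j$, and is unchanged if $x_i=x_j$, and simultaneously $x_j$ is changed by the same rule with the roles of $i$ and $j$ exchanged;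 an arrival of a self-loop changes nothing. Let $\bar x(0)=\frac1n\sum_i x_i(0)$, let $$\mathcal C=\Big\{y\in\mathbb Z^n:\ y_i\in\{\lfloor\bar x(0)\rfloor,\lfloor\bar x(0)\rfloor+1\}\ \text{for all } i,\ \ \tfrac1n\sum_i y_i=\bar x(0)\Big\}$$ be the consensus set, and let $T=\inf\{t\ge 0: x(t)\in\mathcal C\}$ (with $\inf\emptyset=\infty$). Then there is a universal constant $C>0$, independent of $n$, of the graph sequence, of $l$ and $L$ and of the initial values, such that $$\mathbb E[T]\le C\,(L-l)\,n^2\log^2 n .$$ In particular, for a fixed range $[l,L]$ of the initial values, the expected time to reach the consensus set is $O(n^2\log^2 n)$, uniformly over all sequences of connected graphs on $n$ nodes and all initial values in $[l,L]$. -/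

import Mathlib

open MeasureTheory ProbabilityTheory
open scoped NNReal ENNReal

namespace QuantizedMetropolis

noncomputable section

/-- The Metropolis weight `λ_{ij} = 1 / max (d_i) (d_j)` of an edge `{i, j}`; it is `0` if `{i, j}`
is not an edge. -/
def edgeRate {n : ℕ} (G : SimpleGraph (Fin n)) (i j : Fin n) : ℝ :=
  open Classical in
  if G.Adj i j then 1 / (max (G.degree i) (G.degree j) : ℝ) else 0

/-- The rate `λ_{ii} = 1 - (1/2) ∑_j λ_{ij}` of the self-loop at `i`, where the sum is over the
neighbours `j ≠ i` of `i`. -/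
def loopRate {n : ℕ} (G : SimpleGraph (Fin n)) (i : Fin n) : ℝ :=
  open Classical in
  1 - (1 / 2) * ∑ j ∈ G.neighborFinset i, edgeRate G i j

lemma edgeRate_comm {n : ℕ} (G : SimpleGraph (Fin n)) (i j : Fin n) :
    edgeRate G i j = edgeRate G j i := by
  by_cases h : G.Adj i j
  · simp only [edgeRate, h, h.symm, if_true, max_comm]
  · have h2 : ¬ G.Adj j i := fun h3 => h h3.symm
    simp only [edgeRate, h, h2, if_false]

/-- The rate of the clock of the unordered pair `e`: the self-loop rate if `e = {i, i}`, the
Metropolis weight if `e` is an edge of `G`, and `0` (no clock) otherwise. -/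
def clockRate {n : ℕ} (G : SimpleGraph (Fin n)) : Sym2 (Fin n) → ℝ :=
  Sym2.lift ⟨fun i j => if i = j then loopRate G i else edgeRate G i j, fun i j => by
    by_cases h : i = j
    · subst h; rfl
    · simp only [h, Ne.symm h, if_false, edgeRate_comm G i j]⟩

/-- The new value of a node with value `a` when it interacts with a node with value `b`. -/
def step (a b : ℤ) : ℤ :=
  if b < a then a - 1 else if a < b then a + 1 else a

/-- The quantized update of the values `x` when the pair `e = {i, j}` is activated: both endpoints
move by one towards each other (not at all if they are equal); a self-loop changes nothing. -/
def update {n : ℕ} (e : Sym2 (Fin n)) (x : Fin n → ℤ) : Fin n → ℤ :=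
  Sym2.lift ⟨fun i j k =>
      if k = i then step (x i) (x j) else if k = j then step (x j) (x i) else x k,
    fun i j => by
      funext k
      by_cases hi : k = i <;> by_cases hj : k = j
      · subst hi; subst hj; rfl
      · simp [hi, show i ≠ j from fun h => hj (hi.trans h)]
      · simp [hj, show j ≠ i from fun h => hi (hj.trans h)]
      · simp [hi, hj]⟩ e

/-- The average of the values `x`. -/
def average {n : ℕ} (x : Fin n → ℤ) : ℝ := (∑ i, (x i : ℝ)) / n

/-- The consensus set of the initial values `x₀`. -/
def consensusSet {n : ℕ} (x₀ : Fin n → ℤ) : Set (Fin n → ℤ) :=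
  {y | (∀ i, y i = ⌊average x₀⌋ ∨ y i = ⌊average x₀⌋ + 1) ∧ average y = average x₀}

/-- `N` is an (inhomogeneous) Poisson process with rate function `rate`; `N t ω` is the number of
arrivals in `(0, t]`. -/
structure IsPoissonClock {Ω : Type*} [MeasurableSpace Ω] (P : Measure Ω)
    (N : ℝ≥0 → Ω → ℕ) (rate : ℝ → ℝ) : Prop where
  measurable : ∀ t, Measurable (N t)
  /-- Almost surely, the path is a counting path: it starts at `0`, is nondecreasing and
  right-continuous. -/
  path : ∀ᵐ ω ∂P, N 0 ω = 0 ∧ (Monotone fun t => N t ω) ∧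
    ∀ t, ContinuousWithinAt (fun s => N s ω) (Set.Ici t) t
  indep_increments : HasIndepIncrements N P
  law_increments : ∀ s t : ℝ≥0, s ≤ t →
    HasLaw (fun ω => N t ω - N s ω)
      (poissonMeasure (Real.toNNReal (∫ u in (s : ℝ)..(t : ℝ), rate u))) P

/-- The clocks of the time-varying network `𝒢(t) = G ⌊t⌋`: independent Poisson processes, one for
each edge and each self-loop, with rates given at time `t` by `𝒢(t)`. -/
structure AreMetropolisClocks {Ω : Type*} [MeasurableSpace Ω] (P : Measure Ω) {n : ℕ}
    (G : ℕ → SimpleGraph (Fin n)) (N : Sym2 (Fin n) → ℝ≥0 → Ω → ℕ) : Prop where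
  poisson : ∀ e, IsPoissonClock P (N e) fun u => clockRate (G ⌊u⌋₊) e
  indep : iIndepFun (fun e ω t => N e t ω) P

/-- The path `x` starts at `x₀`, stays constant as long as no clock registers an arrival, and is
updated at `e` when the clock of `e` registers an arrival: over a time interval `(s, t]` without
any arrival nothing changes, and over a time interval `(s, t]` with exactly one arrival, at `e`,
the values are transformed by the update at `e`. (Almost surely arrivals are locally finite
and no two are simultaneous, so this determines the path.) -/
structure IsDrivenPath {n : ℕ} (N : Sym2 (Fin n) → ℝ≥0 → ℕ) (x₀ : Fin n → ℤ)
    (x : ℝ≥0 → Fin n → ℤ) : Prop where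
  initial : x 0 = x₀
  no_arrival : ∀ s t, s ≤ t → (∀ e, N e t = N e s) → x t = x s
  one_arrival : ∀ s t e, s ≤ t → N e t = N e s + 1 → (∀ e', e' ≠ e → N e' t = N e' s) →
    x t = update e (x s)

/-- `X` is the quantized Metropolis dynamics over the time-varying network `𝒢(t) = G ⌊t⌋`, with
clocks `N` and initial values `x₀`. -/
structure IsQuantizedMetropolis {Ω : Type*} [MeasurableSpace Ω] (P : Measure Ω) {n : ℕ}
    (G : ℕ → SimpleGraph (Fin n)) (N : Sym2 (Fin n) → ℝ≥0 → Ω → ℕ) (x₀ : Fin n → ℤ)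
    (X : ℝ≥0 → Ω → Fin n → ℤ) : Prop where
  clocks : AreMetropolisClocks P G N
  measurable : ∀ t, Measurable (X t)
  driven : ∀ᵐ ω ∂P, IsDrivenPath (fun e t => N e t ω) x₀ fun t => X t ω

/-- The first time at which the path `x` is in the set `S`, and `∞` if there is none. -/
def hittingTime {n : ℕ} (x : ℝ≥0 → Fin n → ℤ) (S : Set (Fin n → ℤ)) : ℝ≥0∞ :=
  ⨅ (t : ℝ≥0) (_ : x t ∈ S), (t : ℝ≥0∞)

end

end QuantizedMetropolis

/-!
Let `M` and `m` be the largest and smallest values, with `m + 2 ≤ M`. Following the activated edges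
backwards, the event that `a` has value `M` and `b` has value `m` is contained in the event that two
particles started at `a` and `b`, which exchange positions along the activated edges and are killed
when they meet, survive. Hence its probability is a subsolution of a killed pair walk, whose
transition operators are symmetric, so that the varying graphs do no harm in `L²`.

A geodesic of a connected graph has total degree at most `3 n`, since a vertex is adjacent to at
most three of its vertices. With the Metropolis conductances all effective resistances are therefore
of order `n`, and fixing one particle and moving the other yields a Poincaré inequality: the `L²`
norm of the pair walk contracts at rate of order `1 / n ^ 2`. By Cauchy–Schwarz, after time of order
`n ^ 2 * log n` the expected number of pairs `(a, b)` as above is at most `1 / 2`, so that the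
excess of the spread over `1` has decreased by at least `1 / 2` in expectation. Summing over such
time blocks bounds the expected number of blocks that begin without consensus by twice the initial
excess.

Continuous time is reduced to steps by a grid of mesh `1 / K`: a cell with at most one arrival is a
step of the walk, and the probability of a cell with several arrivals before a fixed time vanishes
as `K → ∞`.
-/

namespace QuantizedMetropolis

noncomputable section

section Resistance

variable {V : Type*}

/-- The squared increment of `f` along an unordered pair. -/
def sqDiff (f : V → ℝ) : Sym2 V → ℝ :=
  Sym2.lift ⟨fun a b => (f a - f b) ^ 2, fun a b => by ring⟩

@[simp] lemma sqDiff_mk (f : V → ℝ) (a b : V) : sqDiff f s(a, b) = (f a - f b) ^ 2 := rfl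

lemma sqDiff_nonneg (f : V → ℝ) (e : Sym2 V) : 0 ≤ sqDiff f e := by
  induction e with | _ a b => exact sq_nonneg _

lemma dist_getVert {G : SimpleGraph V} {a b : V} {p : G.Walk a b} (hp : p.length = G.dist a b)
    {k : ℕ} (hk : k ≤ p.length) : G.dist a (p.getVert k) = k := by
  rw [← SimpleGraph.length_eq_dist_of_subwalk hp (p.isSubwalk_take k), p.take_length,
    min_eq_left hk]

lemma card_filter_adj_geodesic_le {G : SimpleGraph V} [DecidableRel G.Adj] (hG : G.Connected)
    {a b : V} {p : G.Walk a b} (hp : p.length = G.dist a b) (v : V) :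
    ((Finset.range (p.length + 1)).filter fun k => G.Adj (p.getVert k) v).card ≤ 3 := by
  have subset_Icc : (Finset.range (p.length + 1)).filter (fun k => G.Adj (p.getVert k) v) ⊆
      Finset.Icc (G.dist a v - 1) (G.dist a v + 1) := by
    intro k hk
    simp only [Finset.mem_filter, Finset.mem_range] at hk
    have hdist := dist_getVert hp (Nat.le_of_lt_succ hk.1)
    have hadj := SimpleGraph.dist_eq_one_iff_adj.2 hk.2
    have hv : G.dist a v ≤ G.dist a (p.getVert k) + G.dist (p.getVert k) v := hG.dist_triangle
    have hk : G.dist a (p.getVert k) ≤ G.dist a v + G.dist v (p.getVert k) := hG.dist_triangle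
    rw [SimpleGraph.dist_comm (u := v)] at hk
    simp only [Finset.mem_Icc]
    omega
  refine (Finset.card_le_card subset_Icc).trans ?_
  simp only [Nat.card_Icc]
  omega

variable [Fintype V]

/-- The Dirichlet form of the network with conductances `c`. -/
def dirichletForm (c : Sym2 V → ℝ) (f : V → ℝ) : ℝ := ∑ e, c e * sqDiff f e

/-- In the network with conductances `c` the effective resistance between any two vertices is at
most `R`; this is expressed through the variational characterisation of effective resistance, so
that no electrical flow has to be constructed. -/
def HasResistanceLE (c : Sym2 V → ℝ) (R : ℝ) : Prop :=
  ∀ f a b, (f a - f b) ^ 2 ≤ R * dirichletForm c f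

lemma dirichletForm_nonneg {c : Sym2 V → ℝ} (hc : ∀ e, 0 ≤ c e) (f : V → ℝ) :
    0 ≤ dirichletForm c f :=
  Finset.sum_nonneg fun e _ => mul_nonneg (hc e) (sqDiff_nonneg f e)

lemma sum_sq_le_sum_dirichletForm {c : Sym2 V → ℝ} {R : ℝ} (hc : HasResistanceLE c R)
    {u : V × V → ℝ} (hu : ∀ a, u (a, a) = 0) :
    ∑ x, u x ^ 2 ≤ (∑ b, dirichletForm c fun a => u (a, b)) * (R * Fintype.card V) := by
  rw [Fintype.sum_prod_type_right, Finset.sum_mul]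
  refine Finset.sum_le_sum fun b _ => ?_
  calc ∑ a, u (a, b) ^ 2 ≤ ∑ _a : V, R * dirichletForm c fun a => u (a, b) :=
        Finset.sum_le_sum fun a _ => by simpa only [hu, sub_zero] using hc (fun a => u (a, b)) a b
    _ = (dirichletForm c fun a => u (a, b)) * (R * Fintype.card V) := by
        rw [Finset.sum_const, Finset.card_univ, nsmul_eq_mul]
        ring

lemma sum_geodesic_le_dirichletForm {G : SimpleGraph V} {c : Sym2 V → ℝ} (hc : ∀ e, 0 ≤ c e)
    (f : V → ℝ) {a b : V} {p : G.Walk a b} (hp : p.length = G.dist a b) :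
    ∑ k ∈ Finset.range p.length, c s(p.getVert k, p.getVert (k + 1)) *
      (f (p.getVert k) - f (p.getVert (k + 1))) ^ 2 ≤ dirichletForm c f := by
  classical
  have edges_injOn : Set.InjOn (fun k => s(p.getVert k, p.getVert (k + 1)))
      (Finset.range p.length : Set ℕ) := by
    intro k hk k' hk' h
    simp only [Finset.coe_range, Set.mem_Iio] at hk hk'
    have := congrArg (Sym2.map (G.dist a)) h
    simp only [Sym2.map_mk, dist_getVert hp hk.le, dist_getVert hp (Nat.succ_le_of_lt hk),
      dist_getVert hp hk'.le, dist_getVert hp (Nat.succ_le_of_lt hk'), Sym2.eq_iff] at this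
    omega
  simp only [← sqDiff_mk]
  rw [← Finset.sum_image (f := fun e => c e * sqDiff f e) edges_injOn]
  exact Finset.sum_le_sum_of_subset_of_nonneg (Finset.subset_univ _)
    fun e _ _ => mul_nonneg (hc e) (sqDiff_nonneg f e)

variable {G : SimpleGraph V} [DecidableRel G.Adj]

lemma sum_degree_geodesic_le (hG : G.Connected) {a b : V} {p : G.Walk a b}
    (hp : p.length = G.dist a b) :
    ∑ k ∈ Finset.range (p.length + 1), G.degree (p.getVert k) ≤ 3 * Fintype.card V := by
  calc ∑ k ∈ Finset.range (p.length + 1), G.degree (p.getVert k)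
      = ∑ k ∈ Finset.range (p.length + 1), ∑ v, if G.Adj (p.getVert k) v then 1 else 0 := by
        simp only [← SimpleGraph.card_neighborFinset_eq_degree,
          SimpleGraph.neighborFinset_eq_filter, Finset.card_filter]
    _ = ∑ v, ((Finset.range (p.length + 1)).filter fun k => G.Adj (p.getVert k) v).card := by
        simp only [Finset.card_filter, Finset.sum_comm (s := Finset.range _)]
    _ ≤ ∑ _v : V, 3 := Finset.sum_le_sum fun v _ => card_filter_adj_geodesic_le hG hp v
    _ = 3 * Fintype.card V := by simp [mul_comm]

lemma sum_max_degree_geodesic_le (hG : G.Connected) {a b : V} {p : G.Walk a b}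
    (hp : p.length = G.dist a b) :
    ∑ k ∈ Finset.range p.length,
      max (G.degree (p.getVert k)) (G.degree (p.getVert (k + 1))) ≤ 6 * Fintype.card V := by
  have htotal := sum_degree_geodesic_le hG hp
  have split_last := Finset.sum_range_succ (fun k => G.degree (p.getVert k)) p.length
  have split_first := Finset.sum_range_succ' (fun k => G.degree (p.getVert k)) p.length
  have hmax := Finset.sum_le_sum fun k (_ : k ∈ Finset.range p.length) =>
    max_le_add_of_nonneg (Nat.zero_le (G.degree (p.getVert k)))
      (Nat.zero_le (G.degree (p.getVert (k + 1))))
  rw [Finset.sum_add_distrib] at hmax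
  omega

theorem hasResistanceLE_of_metropolis (hG : G.Connected) {c : Sym2 V → ℝ} (hc : ∀ e, 0 ≤ c e)
    {κ : ℝ} (hκ : 0 < κ)
    (hadj : ∀ a b, G.Adj a b → κ / (max (G.degree a) (G.degree b) : ℝ) ≤ c s(a, b)) :
    HasResistanceLE c (6 * Fintype.card V / κ) := by
  intro f a b
  obtain ⟨p, hp⟩ := hG.exists_walk_length_eq_dist a b
  let w := p.getVert
  let r : ℕ → ℝ := fun k => max (G.degree (w k) : ℝ) (G.degree (w (k + 1))) / κ
  have r_pos : ∀ k ∈ Finset.range p.length, 0 < r k := fun k hk => by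
    have : 0 < G.degree (w k) := (G.degree_pos_iff_exists_adj _).2
      ⟨_, p.adj_getVert_succ (Finset.mem_range.1 hk)⟩
    exact div_pos (lt_max_of_lt_left (by exact_mod_cast this)) hκ
  have sum_r_le : ∑ k ∈ Finset.range p.length, r k ≤ 6 * Fintype.card V / κ := by
    rw [← Finset.sum_div]
    gcongr
    exact_mod_cast sum_max_degree_geodesic_le hG hp
  have telescope : f a - f b = ∑ k ∈ Finset.range p.length, (f (w k) - f (w (k + 1))) := by
    rw [Finset.sum_range_sub' fun k => f (w k)]
    simp only [w, p.getVert_zero, p.getVert_length]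
  have energy_le : ∑ k ∈ Finset.range p.length, (f (w k) - f (w (k + 1))) ^ 2 / r k ≤
      dirichletForm c f := by
    refine (Finset.sum_le_sum fun k hk => ?_).trans (sum_geodesic_le_dirichletForm hc f hp)
    rw [div_eq_inv_mul, inv_div]
    gcongr
    exact hadj _ _ (p.adj_getVert_succ (Finset.mem_range.1 hk))
  calc (f a - f b) ^ 2
      ≤ (∑ k ∈ Finset.range p.length, r k) *
        ∑ k ∈ Finset.range p.length, (f (w k) - f (w (k + 1))) ^ 2 / r k := by
        rw [telescope]
        refine Finset.sum_sq_le_sum_mul_sum_of_sq_le_mul _ (fun k hk => (r_pos k hk).le)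
          (fun k hk => div_nonneg (sq_nonneg _) (r_pos k hk).le) fun k hk => ?_
        rw [mul_div_cancel₀ _ (r_pos k hk).ne']
    _ ≤ 6 * Fintype.card V / κ * dirichletForm c f :=
        mul_le_mul sum_r_le energy_le
          (Finset.sum_nonneg fun k hk => div_nonneg (sq_nonneg _) (r_pos k hk).le) (by positivity)

end Resistance

section PairWalk

variable {V : Type*} [DecidableEq V]

/-- The transposition of the endpoints of `e`. -/
def swapPerm (e : Sym2 V) : Equiv.Perm V :=
  Sym2.lift ⟨Equiv.swap, Equiv.swap_comm⟩ e

@[simp] lemma swapPerm_mk (a b : V) : swapPerm s(a, b) = Equiv.swap a b := rfl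

/-- The activation of `e`, acting on functions of the positions of two particles: the endpoints of
`e` exchange their particles, and the particles are killed if they meet, that is, if `e` joins
them. -/
def pairMove (e : Sym2 V) (u : V × V → ℝ) (x : V × V) : ℝ :=
  if e = s(x.1, x.2) then 0 else u (swapPerm e x.1, swapPerm e x.2)

variable [Fintype V]

/-- One step of the killed pair walk in which `e` is activated with probability `p e`, and no pair
with the remaining probability. -/
def pairStep (p : Sym2 V → ℝ) (u : V × V → ℝ) (x : V × V) : ℝ :=
  (1 - ∑ e, p e) * u x + ∑ e, p e * pairMove e u x

lemma sum_sq_pairMove_le (e : Sym2 V) (u : V × V → ℝ) :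
    ∑ x, pairMove e u x ^ 2 ≤ ∑ x, u x ^ 2 := by
  rw [← Equiv.sum_comp ((swapPerm e).prodCongr (swapPerm e)) fun x => u x ^ 2]
  refine Finset.sum_le_sum fun x _ => ?_
  unfold pairMove
  split_ifs
  · simpa only [ne_eq, OfNat.ofNat_ne_zero, not_false_eq_true, zero_pow] using sq_nonneg _
  · exact le_rfl

lemma sum_sqDiff_le_sum_sq_sub_pairMove (e : Sym2 V) {u : V × V → ℝ} (hu : ∀ a, u (a, a) = 0) :
    ∑ b, sqDiff (fun a => u (a, b)) e ≤ ∑ x, (u x - pairMove e u x) ^ 2 := by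
  rw [Fintype.sum_prod_type_right]
  refine Finset.sum_le_sum fun b _ => ?_
  induction e with | _ i j =>
  rw [sqDiff_mk]
  have exists_eq : ∃ a, (u (i, b) - u (j, b)) ^ 2 =
      (u (a, b) - pairMove s(i, j) u (a, b)) ^ 2 := by
    rcases eq_or_ne b i with rfl | hbi
    · exact ⟨j, by simp [pairMove, hu, Sym2.eq_swap]⟩
    refine ⟨i, ?_⟩
    rcases eq_or_ne b j with rfl | hbj
    · simp [pairMove, hu]
    have : s(i, j) ≠ s(i, b) := by
      simp only [ne_eq, Sym2.eq_iff]; tauto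
    rw [pairMove, if_neg this, swapPerm_mk, Equiv.swap_apply_left,
      Equiv.swap_apply_of_ne_of_ne hbi hbj]
  obtain ⟨a, ha⟩ := exists_eq
  rw [ha]
  exact Finset.single_le_sum (f := fun a => (u (a, b) - pairMove s(i, j) u (a, b)) ^ 2)
    (fun a _ => sq_nonneg _) (Finset.mem_univ a)

lemma sq_lazy_average_le {ι : Type*} (s : Finset ι) {p : ι → ℝ} (hp : ∀ i ∈ s, 0 ≤ p i) (x : ℝ)
    (y : ι → ℝ) :
    ((1 - ∑ i ∈ s, p i) * x + ∑ i ∈ s, p i * y i) ^ 2 ≤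
      (1 - ∑ i ∈ s, p i) * x ^ 2 + ∑ i ∈ s, p i * y i ^ 2 -
        (1 - ∑ i ∈ s, p i) * ∑ i ∈ s, p i * (x - y i) ^ 2 := by
  have cauchy_schwarz : (∑ i ∈ s, p i * y i) ^ 2 ≤ (∑ i ∈ s, p i) * ∑ i ∈ s, p i * y i ^ 2 :=
    Finset.sum_sq_le_sum_mul_sum_of_sq_le_mul _ hp
      (fun i hi => mul_nonneg (hp i hi) (sq_nonneg _)) fun i _ => le_of_eq (by ring)
  have expand : ∑ i ∈ s, p i * (x - y i) ^ 2 =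
      (∑ i ∈ s, p i) * x ^ 2 - 2 * x * ∑ i ∈ s, p i * y i + ∑ i ∈ s, p i * y i ^ 2 := by
    rw [Finset.sum_mul, Finset.mul_sum, ← Finset.sum_sub_distrib, ← Finset.sum_add_distrib]
    exact Finset.sum_congr rfl fun i _ => by ring
  rw [expand]
  linarith

variable {p : Sym2 V → ℝ} {u : V × V → ℝ}

lemma sum_sq_pairStep_le_sub (hp : ∀ e, 0 ≤ p e) (hp1 : ∑ e, p e ≤ 1)
    (hu : ∀ a, u (a, a) = 0) :
    ∑ x, pairStep p u x ^ 2 ≤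
      ∑ x, u x ^ 2 - (1 - ∑ e, p e) * ∑ b, dirichletForm p fun a => u (a, b) := by
  have move_le : ∑ x, ∑ e, p e * pairMove e u x ^ 2 ≤ (∑ e, p e) * ∑ x, u x ^ 2 := by
    rw [Finset.sum_comm, Finset.sum_mul]
    simp only [← Finset.mul_sum]
    exact Finset.sum_le_sum fun e _ => mul_le_mul_of_nonneg_left (sum_sq_pairMove_le e u) (hp e)
  have dirichlet_le : ∑ b, dirichletForm p (fun a => u (a, b)) ≤
      ∑ x, ∑ e, p e * (u x - pairMove e u x) ^ 2 := by
    unfold dirichletForm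
    rw [Finset.sum_comm, Finset.sum_comm (s := (Finset.univ : Finset (V × V)))]
    simp only [← Finset.mul_sum]
    exact Finset.sum_le_sum fun e _ =>
      mul_le_mul_of_nonneg_left (sum_sqDiff_le_sum_sq_sub_pairMove e hu) (hp e)
  have pointwise := Finset.sum_le_sum fun x (_ : x ∈ Finset.univ) =>
    sq_lazy_average_le Finset.univ (fun e _ => hp e) (u x) fun e => pairMove e u x
  rw [Finset.sum_sub_distrib, Finset.sum_add_distrib, ← Finset.mul_sum, ← Finset.mul_sum]
    at pointwise
  have := mul_le_mul_of_nonneg_left dirichlet_le (sub_nonneg.2 hp1)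
  unfold pairStep
  linarith

theorem sum_sq_pairStep_le {R : ℝ} (hR : 0 ≤ R) (hp : ∀ e, 0 ≤ p e) (hp1 : ∑ e, p e ≤ 1)
    (hpR : HasResistanceLE p R) (hu : ∀ a, u (a, a) = 0) :
    ∑ x, pairStep p u x ^ 2 ≤ (1 - (1 - ∑ e, p e) / (R * Fintype.card V)) * ∑ x, u x ^ 2 := by
  have poincare : (∑ x, u x ^ 2) / (R * Fintype.card V) ≤
      ∑ b, dirichletForm p fun a => u (a, b) :=
    div_le_of_le_mul₀ (by positivity)
      (Finset.sum_nonneg fun b _ => dirichletForm_nonneg hp _)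
      (sum_sq_le_sum_dirichletForm hpR hu)
  calc ∑ x, pairStep p u x ^ 2
      ≤ ∑ x, u x ^ 2 - (1 - ∑ e, p e) * ∑ b, dirichletForm p fun a => u (a, b) :=
        sum_sq_pairStep_le_sub hp hp1 hu
    _ ≤ ∑ x, u x ^ 2 - (1 - ∑ e, p e) * ((∑ x, u x ^ 2) / (R * Fintype.card V)) :=
        sub_le_sub_left (mul_le_mul_of_nonneg_left poincare (sub_nonneg.2 hp1)) _
    _ = (1 - (1 - ∑ e, p e) / (R * Fintype.card V)) * ∑ x, u x ^ 2 := by ring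

end PairWalk

section RandomMoves

variable {E S : Type*} [Fintype E]

/-- The weights `p` are nonnegative of total mass at most `1`; the missing mass is the probability
of making no move. -/
def IsSubprob (p : E → ℝ) : Prop := (∀ e, 0 ≤ p e) ∧ ∑ e, p e ≤ 1

/-- The transition operator of a step in which the move of `e` is made with probability `p e`, and
no move with the remaining probability. -/
def stepOp (move : E → S → S) (p : E → ℝ) : (S → ℝ) →ₗ[ℝ] (S → ℝ) :=
  (1 - ∑ e, p e) • LinearMap.id + ∑ e, p e • LinearMap.funLeft ℝ ℝ (move e)

lemma stepOp_apply (move : E → S → S) (p : E → ℝ) (f : S → ℝ) (y : S) :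
    stepOp move p f y = (1 - ∑ e, p e) * f y + ∑ e, p e * f (move e y) := by
  simp [stepOp, LinearMap.sum_apply]

/-- The transition operator of the first `k` steps, where `p j` are the weights of step `j`:
`evolve move p k f y` is the expectation of `f` after `k` steps from `y`. -/
def evolve (move : E → S → S) (p : ℕ → E → ℝ) : ℕ → (S → ℝ) →ₗ[ℝ] (S → ℝ)
  | 0 => LinearMap.id
  | k + 1 => evolve move p k ∘ₗ stepOp move (p k)

variable {move : E → S → S} {p : ℕ → E → ℝ}

lemma evolve_zero (f : S → ℝ) : evolve move p 0 f = f := rfl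

lemma evolve_succ (k : ℕ) (f : S → ℝ) :
    evolve move p (k + 1) f = evolve move p k (stepOp move (p k) f) := rfl

lemma evolve_add (k l : ℕ) (f : S → ℝ) :
    evolve move p (k + l) f = evolve move p k (evolve move (fun j => p (k + j)) l f) := by
  induction l generalizing f with
  | zero => rfl
  | succ l ih => rw [← add_assoc, evolve_succ, ih, evolve_succ]

lemma evolve_mono (hp : ∀ j, IsSubprob (p j)) {B : Set S} (hB : ∀ e, Set.MapsTo (move e) B B)
    (k : ℕ) {f g : S → ℝ} (hfg : ∀ y ∈ B, f y ≤ g y) :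
    ∀ y ∈ B, evolve move p k f y ≤ evolve move p k g y := by
  induction k generalizing f g with
  | zero => exact hfg
  | succ k ih =>
    refine ih fun y hy => ?_
    rw [stepOp_apply, stepOp_apply]
    have := (hp k).2
    gcongr with e _
    · exact hfg y hy
    · exact (hp k).1 e
    · exact hfg _ (hB e hy)

lemma evolve_le_evolve (hp : ∀ j, IsSubprob (p j)) (k : ℕ) {f g : S → ℝ} (hfg : f ≤ g) :
    evolve move p k f ≤ evolve move p k g := fun y =>
  evolve_mono hp (fun e => Set.mapsTo_univ (move e) _) k (fun y _ => hfg y) y (Set.mem_univ y)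

lemma evolve_const (k : ℕ) (c : ℝ) : evolve move p k (fun _ => c) = fun _ => c := by
  induction k with
  | zero => rfl
  | succ k ih =>
    have : stepOp move (p k) (fun _ => c) = fun _ => c := by
      funext y
      rw [stepOp_apply, ← Finset.sum_mul]
      ring
    rw [evolve_succ, this, ih]

lemma evolve_nonneg (hp : ∀ j, IsSubprob (p j)) (k : ℕ) {f : S → ℝ} (hf : 0 ≤ f) :
    0 ≤ evolve move p k f := by
  simpa only [map_zero] using evolve_le_evolve hp k hf

lemma exists_norm_stepOp_le (p : E → ℝ) {f : S → ℝ} (hf : ∃ C, ∀ y, ‖f y‖ ≤ C) :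
    ∃ C, ∀ y, ‖stepOp move p f y‖ ≤ C := by
  obtain ⟨C, hC⟩ := hf
  refine ⟨‖1 - ∑ e, p e‖ * C + ∑ e, ‖p e‖ * C, fun y => ?_⟩
  rw [stepOp_apply]
  refine (norm_add_le _ _).trans (add_le_add ?_ ((norm_sum_le _ _).trans ?_))
  · rw [norm_mul]
    gcongr
    exact hC y
  · simp only [norm_mul]
    gcongr
    exact hC _

end RandomMoves

section Trajectories

variable {E S : Type*} [DecidableEq E]

lemma single_one_injective : Function.Injective fun e : E => (Pi.single e 1 : E → ℕ) := by
  intro e e' h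
  by_contra hne
  simpa [hne] using congrFun h e

/-- The effect of the numbers `z` of arrivals in a time cell: the move of `e` if there is exactly
one arrival, at `e`, and no move otherwise. The second rule ignores cells with several arrivals,
where the order of the arrivals would matter. -/
def fire (move : E → S → S) (z : E → ℕ) (y : S) : S :=
  open Classical in
  if h : ∃ e, z = Pi.single e 1 then move h.choose y else y

/-- The trajectory from `x₀` driven by the numbers of arrivals in the successive time cells. -/
def traj (move : E → S → S) (x₀ : S) (z : ℕ → E → ℕ) : ℕ → S
  | 0 => x₀
  | j + 1 => fire move (z j) (traj move x₀ z j)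

variable {move : E → S → S}

lemma fire_single (e : E) (y : S) : fire move (Pi.single e 1) y = move e y := by
  have h : ∃ e', (Pi.single e 1 : E → ℕ) = Pi.single e' 1 := ⟨e, rfl⟩
  rw [fire, dif_pos h, ← single_one_injective h.choose_spec]

lemma fire_of_forall_ne {z : E → ℕ} (hz : ∀ e, z ≠ Pi.single e 1) (y : S) : fire move z y = y :=
  dif_neg fun ⟨e, he⟩ => hz e he

lemma apply_fire [Fintype E] (f : S → ℝ) (z : E → ℕ) (y : S) :
    f (fire move z y) =
      f y + ∑ e, Set.indicator {Pi.single e 1} 1 z * (f (move e y) - f y) := by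
  by_cases h : ∃ e, z = Pi.single e 1
  · obtain ⟨e, rfl⟩ := h
    rw [fire_single, Finset.sum_eq_single e]
    · simp
    · intro e' _ hne
      simp [single_one_injective.ne hne.symm]
    · simp
  · push Not at h
    simp [fire_of_forall_ne h, h]

lemma traj_congr (x₀ : S) {z z' : ℕ → E → ℕ} (j : ℕ) (h : ∀ i < j, z i = z' i) :
    traj move x₀ z j = traj move x₀ z' j := by
  induction j with
  | zero => rfl
  | succ j ih =>
    rw [traj, traj, ih fun i hi => h i (hi.trans j.lt_succ_self), h j j.lt_succ_self]

lemma traj_mem {x₀ : S} {B : Set S} (hx : x₀ ∈ B) (hB : ∀ e, Set.MapsTo (move e) B B)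
    (z : ℕ → E → ℕ) (j : ℕ) : traj move x₀ z j ∈ B := by
  induction j with
  | zero => exact hx
  | succ j ih =>
    rw [traj]
    by_cases h : ∃ e, z j = Pi.single e 1
    · obtain ⟨e, he⟩ := h
      rw [he, fire_single]
      exact hB e ih
    · push Not at h
      rwa [fire_of_forall_ne h]

variable [MeasurableSpace S] {Ω : Type*} [MeasurableSpace Ω] {P : Measure Ω}

lemma indepFun_traj [Finite E] {z : ℕ → Ω → E → ℕ} (hz : ∀ j e, Measurable fun ω => z j ω e)
    (hind : iIndepFun (fun (q : E × ℕ) ω => z q.2 ω q.1) P) (x₀ : S) (j : ℕ) :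
    IndepFun (fun ω => traj move x₀ (fun i => z i ω) j) (z j) P := by
  cases nonempty_fintype E
  set past : Finset (E × ℕ) := Finset.univ ×ˢ Finset.range j
  set present : Finset (E × ℕ) := Finset.univ ×ˢ {j}
  have disjoint_past_present : Disjoint past present :=
    Finset.disjoint_product.2 (Or.inr (by simp))
  let φ : (past → ℕ) → S := fun v =>
    traj move x₀ (fun i e => if h : (e, i) ∈ past then v ⟨(e, i), h⟩ else 0) j
  let ψ : (present → ℕ) → E → ℕ := fun v e => v ⟨(e, j), by simp [present]⟩
  have traj_eq : φ ∘ (fun ω (q : past) => z q.1.2 ω q.1.1) =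
      fun ω => traj move x₀ (fun i => z i ω) j := by
    funext ω
    refine traj_congr x₀ j fun i hi => ?_
    funext e
    have : (e, i) ∈ past := by simp [past, hi]
    simp [this]
  rw [← traj_eq]
  exact (hind.indepFun_finset past present disjoint_past_present fun q => hz q.2 q.1).comp
    (measurable_of_countable φ) (measurable_of_countable ψ)

variable [Countable S] [MeasurableSingletonClass S]

lemma measurable_traj [Finite E] (x₀ : S) {z : ℕ → Ω → E → ℕ} (hz : ∀ j, Measurable (z j)) (j : ℕ) :
    Measurable fun ω => traj move x₀ (fun i => z i ω) j := by
  induction j with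
  | zero => exact measurable_const
  | succ j ih =>
    exact (measurable_of_countable fun q : (E → ℕ) × S => fire move q.1 q.2).comp
      ((hz j).prodMk ih)

variable [Fintype E]

lemma integrable_comp [IsFiniteMeasure P] {Y : Ω → S} (hY : Measurable Y) {f : S → ℝ}
    (hf : ∃ C, ∀ y, ‖f y‖ ≤ C) : Integrable (fun ω => f (Y ω)) P :=
  let ⟨C, hC⟩ := hf
  Integrable.of_bound ((measurable_of_countable f).comp hY).aestronglyMeasurable C
    (Filter.Eventually.of_forall fun ω => hC (Y ω))

lemma integral_fire [IsFiniteMeasure P] {Y : Ω → S} {Z : Ω → E → ℕ} (hY : Measurable Y)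
    (hZ : Measurable Z) (hYZ : IndepFun Y Z P) {f : S → ℝ} (hf : ∃ C, ∀ y, ‖f y‖ ≤ C) :
    ∫ ω, f (fire move (Z ω) (Y ω)) ∂P =
      ∫ ω, stepOp move (fun e => P.real {ω | Z ω = Pi.single e 1}) f (Y ω) ∂P := by
  have hint : Integrable (fun ω => f (Y ω)) P := integrable_comp hY hf
  have hint_move (e : E) : Integrable (fun ω => f (move e (Y ω))) P :=
    integrable_comp (f := fun y => f (move e y)) hY (hf.imp fun C hC y => hC _)
  let single_ind (e : E) (ω : Ω) : ℝ := Set.indicator {Pi.single e 1} 1 (Z ω)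
  have measurable_ind (e : E) : Measurable (single_ind e) :=
    (measurable_of_countable (Set.indicator {Pi.single e 1} 1)).comp hZ
  have integral_single (e : E) : ∫ ω, single_ind e ω ∂P = P.real {ω | Z ω = Pi.single e 1} := by
    have hE : MeasurableSet {ω | Z ω = Pi.single e 1} := hZ (MeasurableSet.singleton _)
    rw [← integral_indicator_one hE]
    rfl
  have hint_ind (e : E) :
      Integrable (fun ω => single_ind e ω * (f (move e (Y ω)) - f (Y ω))) P := by
    refine ((hint_move e).sub hint).bdd_mul (c := 1) (measurable_ind e).aestronglyMeasurable
      (Filter.Eventually.of_forall fun ω => ?_)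
    simp only [single_ind, Set.indicator]
    split_ifs <;> simp
  have integral_ind (e : E) : ∫ ω, single_ind e ω * (f (move e (Y ω)) - f (Y ω)) ∂P =
      P.real {ω | Z ω = Pi.single e 1} * (∫ ω, f (move e (Y ω)) ∂P - ∫ ω, f (Y ω) ∂P) := by
    rw [← integral_single, ← integral_sub (hint_move e) hint]
    exact hYZ.symm.integral_fun_comp_mul_comp (f := Set.indicator {Pi.single e 1} 1)
      (g := fun y => f (move e y) - f y) hZ.aemeasurable hY.aemeasurable
      (measurable_of_countable _).aestronglyMeasurable
      (measurable_of_countable _).aestronglyMeasurable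
  have fire_eq (ω : Ω) : f (fire move (Z ω) (Y ω)) =
      f (Y ω) + ∑ e, single_ind e ω * (f (move e (Y ω)) - f (Y ω)) := apply_fire f (Z ω) (Y ω)
  simp only [fire_eq, stepOp_apply]
  rw [integral_add hint (integrable_finsetSum _ fun e _ => hint_ind e),
    integral_add (hint.const_mul _) (integrable_finsetSum _ fun e _ => (hint_move e).const_mul _),
    integral_finsetSum _ fun e _ => hint_ind e,
    integral_finsetSum _ fun e _ => (hint_move e).const_mul _]
  simp only [integral_ind, integral_const_mul]
  simp only [mul_sub, Finset.sum_sub_distrib, ← Finset.sum_mul]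
  ring

theorem integral_traj [IsProbabilityMeasure P] {z : ℕ → Ω → E → ℕ}
    (hz : ∀ j e, Measurable fun ω => z j ω e)
    (hind : iIndepFun (fun (q : E × ℕ) ω => z q.2 ω q.1) P) (x₀ : S) (j : ℕ) {f : S → ℝ}
    (hf : ∃ C, ∀ y, ‖f y‖ ≤ C) :
    ∫ ω, f (traj move x₀ (fun i => z i ω) j) ∂P =
      evolve move (fun i e => P.real {ω | z i ω = Pi.single e 1}) j f x₀ := by
  induction j generalizing f with
  | zero => simp [traj, evolve_zero]
  | succ j ih =>
    have hz' (i : ℕ) : Measurable (z i) := measurable_pi_lambda _ (hz i)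
    simp only [traj]
    rw [integral_fire (measurable_traj x₀ hz' j) (hz' j) (indepFun_traj hz hind x₀ j) hf,
      ih (exists_norm_stepOp_le _ hf), evolve_succ]

end Trajectories

section ExtremePairs

variable {n : ℕ} {m M : ℤ} {y : Fin n → ℤ}

lemma update_mk (i j k : Fin n) (y : Fin n → ℤ) :
    update s(i, j) y k =
      if k = i then step (y i) (y j) else if k = j then step (y j) (y i) else y k := rfl

lemma sum_update (e : Sym2 (Fin n)) (y : Fin n → ℤ) : ∑ k, update e y k = ∑ k, y k := by
  induction e with | _ i j =>
  rcases eq_or_ne i j with rfl | hij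
  · refine Finset.sum_congr rfl fun k _ => ?_
    rw [update_mk]
    unfold step
    split_ifs <;> simp_all
  · have update_eq (k : Fin n) : update s(i, j) y k =
        y k + ((if k = i then step (y i) (y j) - y i else 0) +
          if k = j then step (y j) (y i) - y j else 0) := by
      rw [update_mk]
      split_ifs <;> simp_all
    have step_antisymm : step (y i) (y j) - y i + (step (y j) (y i) - y j) = 0 := by
      unfold step
      split_ifs <;> omega
    simp only [update_eq, Finset.sum_add_distrib, Finset.sum_ite_eq', Finset.mem_univ, if_true,
      step_antisymm, add_zero]

/-- The states all of whose values lie in `[m, M]`. -/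
def box (n : ℕ) (m M : ℤ) : Set (Fin n → ℤ) := {y | ∀ i, m ≤ y i ∧ y i ≤ M}

lemma mapsTo_update_box (e : Sym2 (Fin n)) : Set.MapsTo (update e) (box n m M) (box n m M) := by
  induction e with | _ i j =>
  intro y hy k
  have hi := hy i
  have hj := hy j
  have hk := hy k
  rw [update_mk]
  unfold step
  split_ifs <;> omega

lemma apply_swapPerm_eq_max (hy : ∀ i, y i ≤ M) {e : Sym2 (Fin n)} {a : Fin n}
    (h : update e y a = M) : y (swapPerm e a) = M := by
  induction e with | _ i j =>
  have hi := hy i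
  have hj := hy j
  rw [update_mk] at h
  rw [swapPerm_mk, Equiv.swap_apply_def]
  unfold step at h
  split_ifs at * <;> omega

lemma apply_swapPerm_eq_min (hy : ∀ i, m ≤ y i) {e : Sym2 (Fin n)} {a : Fin n}
    (h : update e y a = m) : y (swapPerm e a) = m := by
  induction e with | _ i j =>
  have hi := hy i
  have hj := hy j
  rw [update_mk] at h
  rw [swapPerm_mk, Equiv.swap_apply_def]
  unfold step at h
  split_ifs at * <;> omega

/-- The indicator, as a function of the state, of the event that `x.1` has value `M` and `x.2` has
value `m`. -/
def extremePair (M m : ℤ) (x : Fin n × Fin n) : (Fin n → ℤ) → ℝ :=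
  Set.indicator {y | y x.1 = M ∧ y x.2 = m} 1

lemma extremePair_nonneg (x : Fin n × Fin n) : 0 ≤ extremePair M m x :=
  Set.indicator_nonneg fun _ _ => zero_le_one

lemma extremePair_le_one (x : Fin n × Fin n) : extremePair M m x ≤ 1 :=
  Set.indicator_le_self' fun _ _ => zero_le_one

lemma extremePair_update_le (hmM : m + 2 ≤ M) (e : Sym2 (Fin n)) (hy : y ∈ box n m M)
    (x : Fin n × Fin n) :
    extremePair M m x (update e y) ≤ pairMove e (fun x => extremePair M m x y) x := by
  obtain ⟨a, b⟩ := x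
  by_cases hab : update e y a = M ∧ update e y b = m
  · have hmax : y (swapPerm e a) = M := apply_swapPerm_eq_max (fun i => (hy i).2) hab.1
    have hmin : y (swapPerm e b) = m := apply_swapPerm_eq_min (fun i => (hy i).1) hab.2
    have not_meet : e ≠ s(a, b) := by
      rintro rfl
      rw [swapPerm_mk, Equiv.swap_apply_left] at hmax
      rw [swapPerm_mk, Equiv.swap_apply_right] at hmin
      have := hab.1
      rw [update_mk, if_pos rfl] at this
      unfold step at this
      split_ifs at this <;> omega
    simp [pairMove, not_meet, extremePair, hab, hmax, hmin]
  · have pairMove_nonneg : 0 ≤ pairMove e (fun x => extremePair M m x y) (a, b) := by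
      unfold pairMove
      split_ifs
      · exact le_rfl
      · exact extremePair_nonneg _ y
    simpa [extremePair, hab] using pairMove_nonneg

variable {p : ℕ → Sym2 (Fin n) → ℝ}

lemma evolve_extremePair_succ_le (hp : ∀ j, IsSubprob (p j)) (hmM : m + 2 ≤ M) (k : ℕ)
    (hy : y ∈ box n m M) (x : Fin n × Fin n) :
    evolve update p (k + 1) (extremePair M m x) y ≤
      pairStep (p k) (fun x => evolve update p k (extremePair M m x) y) x := by
  have stepOp_le : ∀ z ∈ box n m M, stepOp update (p k) (extremePair M m x) z ≤
      ((1 - ∑ e, p k e) • extremePair M m x + ∑ e, p k e •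
        fun z => pairMove e (fun x => extremePair M m x z) x : (Fin n → ℤ) → ℝ) z := by
    intro z hz
    rw [stepOp_apply]
    simp only [Pi.add_apply, Pi.smul_apply, smul_eq_mul, Finset.sum_apply]
    gcongr with e _
    · exact (hp k).1 e
    · exact extremePair_update_le hmM e hz x
  have evolve_pairMove (e : Sym2 (Fin n)) :
      evolve update p k (fun z => pairMove e (fun x => extremePair M m x z) x) y =
        pairMove e (fun x => evolve update p k (extremePair M m x) y) x := by
    unfold pairMove
    split_ifs
    · rw [evolve_const]
    · rfl
  rw [evolve_succ]
  refine (evolve_mono hp mapsTo_update_box k stepOp_le y hy).trans_eq ?_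
  simp only [map_add, map_smul, map_sum, Pi.add_apply, Pi.smul_apply, smul_eq_mul,
    Finset.sum_apply, evolve_pairMove]
  rfl

/-- Probabilities of activation, in one step, of the edges of a network which is idle with
probability at least `1 / 2` and has all effective resistances at most `R` when the conductances
are the activation probabilities. -/
structure IsLazyActivation {V : Type*} [Fintype V] [DecidableEq V] (p : Sym2 V → ℝ) (R : ℝ) :
    Prop where
  nonneg : ∀ e, 0 ≤ p e
  sum_le : ∑ e, p e ≤ 1 / 2
  hasResistanceLE : HasResistanceLE p R

lemma IsLazyActivation.isSubprob {V : Type*} [Fintype V] [DecidableEq V] {p : Sym2 V → ℝ} {R : ℝ}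
    (hp : IsLazyActivation p R) : IsSubprob p :=
  ⟨hp.nonneg, hp.sum_le.trans (by norm_num)⟩

theorem sum_sq_evolve_extremePair_le {R : ℝ} (hR : 0 ≤ R) (hp : ∀ j, IsLazyActivation (p j) R)
    (hmM : m + 2 ≤ M) (k : ℕ) (hy : y ∈ box n m M) :
    ∑ x, evolve update p k (extremePair M m x) y ^ 2 ≤
      (n : ℝ) ^ 2 * Real.exp (-(k / (2 * R * n))) := by
  have hsub (j : ℕ) : IsSubprob (p j) := (hp j).isSubprob
  induction k with
  | zero =>
    have sq_le_one (x : Fin n × Fin n) : extremePair M m x y ^ 2 ≤ 1 :=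
      pow_le_one₀ (extremePair_nonneg x y) (extremePair_le_one x y)
    simpa [evolve_zero, sq] using Finset.sum_le_sum fun x (_ : x ∈ Finset.univ) => sq_le_one x
  | succ k ih =>
    have diagonal (a : Fin n) : evolve update p k (extremePair M m (a, a)) y = 0 := by
      have : extremePair M m (a, a) = fun _ : Fin n → ℤ => 0 := by
        funext z
        exact Set.indicator_of_notMem (by simp only [Set.mem_ofPred_eq]; omega) _
      rw [this, evolve_const]
    have contraction : 1 - (1 - ∑ e, p k e) / (R * n) ≤ Real.exp (-(1 / (2 * R * n))) := by
      refine le_trans ?_ (Real.one_sub_le_exp_neg _)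
      have : 1 / (2 * R * n) = 1 / 2 / (R * n) := by rw [div_div, mul_assoc]
      rw [this]
      gcongr
      linarith [(hp k).sum_le]
    calc ∑ x, evolve update p (k + 1) (extremePair M m x) y ^ 2
        ≤ ∑ x, pairStep (p k) (fun x => evolve update p k (extremePair M m x) y) x ^ 2 := by
          gcongr with x _
          · exact evolve_nonneg hsub (k + 1) (extremePair_nonneg x) y
          · exact evolve_extremePair_succ_le hsub hmM k hy x
      _ ≤ (1 - (1 - ∑ e, p k e) / (R * n)) *
            ∑ x, evolve update p k (extremePair M m x) y ^ 2 := by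
          simpa only [Fintype.card_fin] using sum_sq_pairStep_le hR (hp k).nonneg (hsub k).2
            (hp k).hasResistanceLE diagonal
      _ ≤ Real.exp (-(1 / (2 * R * n))) * ((n : ℝ) ^ 2 * Real.exp (-(k / (2 * R * n)))) := by
          gcongr
      _ = (n : ℝ) ^ 2 * Real.exp (-((k + 1 : ℕ) / (2 * R * n))) := by
          rw [mul_left_comm, ← Real.exp_add]
          congr 2
          push_cast
          ring

end ExtremePairs

section Spread

variable {n : ℕ}

/-- The difference of the largest and the smallest value. -/
def spread (y : Fin n → ℤ) : ℤ := (⨆ i, y i) - ⨅ i, y i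

/-- The excess of the spread over `1`, or `0` if the spread is `0`. -/
def excess (y : Fin n → ℤ) : ℝ := (max (spread y - 1) 0 : ℤ)

lemma excess_nonneg : 0 ≤ (excess : (Fin n → ℤ) → ℝ) := fun _ =>
  Int.cast_nonneg (le_max_right _ _)

variable [NeZero n] {m M : ℤ} {y : Fin n → ℤ}

lemma exists_extremes (y : Fin n → ℤ) :
    ∃ a b, y ∈ box n (y b) (y a) ∧ spread y = y a - y b := by
  obtain ⟨a, ha⟩ := exists_eq_ciSup_of_finite (f := y)
  obtain ⟨b, hb⟩ := exists_eq_ciInf_of_finite (f := y)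
  refine ⟨a, b, fun i => ⟨?_, ?_⟩, by rw [ha, hb, spread]⟩
  · exact hb.trans_le (ciInf_le (Set.finite_range y).bddBelow i)
  · exact (le_ciSup (Set.finite_range y).bddAbove i).trans_eq ha.symm

/-- The states in which two values differ by at least `2`. -/
def wideStates (n : ℕ) : Set (Fin n → ℤ) := {y | 2 ≤ spread y}

lemma mem_consensusSet {x₀ : Fin n → ℤ} (hsum : ∑ i, y i = ∑ i, x₀ i) (hy : y ∉ wideStates n) :
    y ∈ consensusSet x₀ := by
  have hn : (0 : ℝ) < n := by exact_mod_cast NeZero.pos n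
  have average_eq : average y = average x₀ := by
    unfold average
    exact_mod_cast congrArg (fun s : ℤ => (s : ℝ) / n) hsum
  obtain ⟨a, b, hbox, hspread⟩ := exists_extremes y
  have le_succ (i : Fin n) : y i ≤ y b + 1 := by
    have hab : ¬ 2 ≤ spread y := hy
    have := (hbox i).2
    omega
  have floor_average : ⌊average x₀⌋ = y b := by
    rw [← average_eq, Int.floor_eq_iff, average, le_div_iff₀ hn, div_lt_iff₀ hn]
    constructor
    · have : ∑ _i : Fin n, (y b : ℝ) ≤ ∑ i, (y i : ℝ) :=
        Finset.sum_le_sum fun i _ => by exact_mod_cast (hbox i).1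
      simpa [mul_comm] using this
    · have : ∑ i, (y i : ℝ) < ∑ _i : Fin n, ((y b : ℝ) + 1) :=
        Finset.sum_lt_sum (fun i _ => by exact_mod_cast le_succ i)
          ⟨b, Finset.mem_univ b, by linarith⟩
      simpa [mul_comm, mul_add] using this
  refine ⟨fun i => ?_, average_eq⟩
  have := (hbox i).1
  have := le_succ i
  omega

lemma spread_le_of_mem_box (hy : y ∈ box n m M) : spread y ≤ M - m := by
  obtain ⟨a, b, _, hspread⟩ := exists_extremes y
  have := (hy a).2
  have := (hy b).1
  omega

lemma excess_le_of_mem_box (hmM : m + 1 ≤ M) (hy : y ∈ box n m M) : excess y ≤ M - m - 1 := by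
  have := spread_le_of_mem_box hy
  have : max (spread y - 1) 0 ≤ M - m - 1 := by omega
  unfold excess
  exact_mod_cast this

lemma excess_le (hy : y ∈ box n m M) : excess y ≤ M - m := by
  have := spread_le_of_mem_box hy
  have := hy 0
  have : max (spread y - 1) 0 ≤ M - m := by omega
  unfold excess
  exact_mod_cast this

lemma excess_le_add_sum_extremePair (hmM : m + 2 ≤ M) (hy : y ∈ box n m M) :
    excess y ≤ (M - m - 2 : ℝ) + ∑ x, extremePair M m x y := by
  obtain ⟨a, b, -, hspread⟩ := exists_extremes y
  by_cases hab : y a = M ∧ y b = m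
  · have one_le : (1 : ℝ) ≤ ∑ x, extremePair M m x y :=
      calc (1 : ℝ) = extremePair M m (a, b) y := by simp [extremePair, hab]
        _ ≤ ∑ x, extremePair M m x y :=
          Finset.single_le_sum (fun x _ => extremePair_nonneg x y) (Finset.mem_univ (a, b))
    linarith [excess_le_of_mem_box (by omega) hy]
  · have sum_nonneg : 0 ≤ ∑ x, extremePair M m x y :=
      Finset.sum_nonneg fun x _ => extremePair_nonneg x y
    have : max (spread y - 1) 0 ≤ M - m - 2 := by
      have := hy a
      have := hy b
      omega
    have : excess y ≤ (M - m - 2 : ℝ) := by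
      unfold excess
      exact_mod_cast this
    linarith

variable {R : ℝ} {p : ℕ → Sym2 (Fin n) → ℝ} {k : ℕ}

lemma sum_evolve_extremePair_le_half (hR : 0 < R) (hp : ∀ j, IsLazyActivation (p j) R)
    (hk : 4 * R * n * Real.log (2 * n ^ 2) ≤ k) (hmM : m + 2 ≤ M) (hy : y ∈ box n m M) :
    ∑ x, evolve update p k (extremePair M m x) y ≤ 1 / 2 := by
  have hn : (0 : ℝ) < n := by exact_mod_cast NeZero.pos n
  have exp_le : Real.exp (-(k / (2 * R * n))) ≤ (1 / (2 * (n : ℝ) ^ 2)) ^ 2 := by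
    have : (1 / (2 * (n : ℝ) ^ 2)) ^ 2 = Real.exp (-(2 * Real.log (2 * (n : ℝ) ^ 2))) := by
      rw [Real.exp_neg, two_mul (Real.log _), Real.exp_add, Real.exp_log (by positivity)]
      field_simp
    rw [this, Real.exp_le_exp, neg_le_neg_iff, le_div_iff₀ (by positivity)]
    linarith
  refine le_of_sq_le_sq (?_ : _ ≤ (1 / 2 : ℝ) ^ 2) (by norm_num)
  calc (∑ x, evolve update p k (extremePair M m x) y) ^ 2
      ≤ (n : ℝ) ^ 2 * ∑ x, evolve update p k (extremePair M m x) y ^ 2 := by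
        simpa [sq] using sq_sum_le_card_mul_sum_sq (s := Finset.univ)
          (f := fun x => evolve update p k (extremePair M m x) y)
    _ ≤ (n : ℝ) ^ 2 * ((n : ℝ) ^ 2 * (1 / (2 * (n : ℝ) ^ 2)) ^ 2) := by
        gcongr
        exact (sum_sq_evolve_extremePair_le hR.le hp hmM k hy).trans (by gcongr)
    _ = (1 / 2) ^ 2 := by field_simp

theorem evolve_excess_le (hR : 0 < R) (hp : ∀ j, IsLazyActivation (p j) R)
    (hk : 4 * R * n * Real.log (2 * n ^ 2) ≤ k) :
    evolve update p k excess ≤ excess - (1 / 2 : ℝ) • (wideStates n).indicator 1 := by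
  intro y
  have hsub (j : ℕ) : IsSubprob (p j) := (hp j).isSubprob
  obtain ⟨a, b, hy, hspread⟩ := exists_extremes y
  by_cases hwide : y ∈ wideStates n
  · have hab : y b + 2 ≤ y a := by
      have : 2 ≤ spread y := hwide
      omega
    have excess_eq : excess y = y a - y b - 1 := by
      have : max (spread y - 1) 0 = y a - y b - 1 := by omega
      unfold excess
      exact_mod_cast this
    have evolve_le := evolve_mono hsub mapsTo_update_box k
      (g := (fun _ => (y a - y b - 2 : ℝ)) + ∑ x, extremePair (y a) (y b) x)
      (fun z hz => by simpa using excess_le_add_sum_extremePair hab hz) y hy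
    simp only [map_add, evolve_const, map_sum, Pi.add_apply, Finset.sum_apply] at evolve_le
    have half := sum_evolve_extremePair_le_half hR hp hk hab hy
    simp only [Pi.sub_apply, Pi.smul_apply, Set.indicator_of_mem hwide, Pi.one_apply, smul_eq_mul]
    linarith
  · have excess_le : ∀ z ∈ box n (y b) (y a), excess z ≤ excess y := by
      intro z hz
      have := spread_le_of_mem_box hz
      have : max (spread z - 1) 0 ≤ max (spread y - 1) 0 := by omega
      unfold excess
      exact_mod_cast this
    simpa [Set.indicator_of_notMem hwide, evolve_const] using
      evolve_mono hsub mapsTo_update_box k excess_le y hy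

theorem sum_evolve_wideStates_le (hR : 0 < R) (hp : ∀ j, IsLazyActivation (p j) R)
    (hk : 4 * R * n * Real.log (2 * n ^ 2) ≤ k) (y : Fin n → ℤ) (r : ℕ) :
    ∑ i ∈ Finset.range r, evolve update p (i * k) ((wideStates n).indicator 1) y ≤
      2 * excess y := by
  have hsub (j : ℕ) : IsSubprob (p j) := (hp j).isSubprob
  have telescope (r : ℕ) :
      1 / 2 * ∑ i ∈ Finset.range r, evolve update p (i * k) ((wideStates n).indicator 1) y ≤
        excess y - evolve update p (r * k) excess y := by
    induction r with
    | zero => simp [evolve_zero]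
    | succ r ih =>
      have block := evolve_le_evolve hsub (move := update) (r * k)
        (evolve_excess_le hR (fun j => hp (r * k + j)) hk) y
      rw [← evolve_add, ← Nat.succ_mul, map_sub, map_smul] at block
      simp only [Pi.sub_apply, Pi.smul_apply, smul_eq_mul] at block
      rw [Finset.sum_range_succ]
      linarith
  have excess_nonneg : 0 ≤ evolve update p (r * k) excess y :=
    evolve_nonneg hsub (r * k) excess_nonneg y
  linarith [telescope r]

end Spread

section ClockRates

variable {n : ℕ} (G : SimpleGraph (Fin n))

open Classical in
lemma clockRate_adj {G : SimpleGraph (Fin n)} {i j : Fin n} (h : G.Adj i j) :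
    clockRate G s(i, j) = 1 / (max (G.degree i) (G.degree j) : ℝ) := by
  simp [clockRate, h.ne, edgeRate, h]

lemma edgeRate_nonneg (i j : Fin n) : 0 ≤ edgeRate G i j := by
  unfold edgeRate
  split_ifs <;> positivity

open Classical in
lemma edgeRate_le_inv_degree (i j : Fin n) : edgeRate G i j ≤ (G.degree i : ℝ)⁻¹ := by
  unfold edgeRate
  split_ifs with h
  · have : 0 < G.degree i := (G.degree_pos_iff_exists_adj i).2 ⟨j, h⟩
    rw [one_div]
    gcongr
    exact le_max_left _ _
  · positivity

open Classical in
lemma sum_edgeRate_le_one (i : Fin n) : ∑ j ∈ G.neighborFinset i, edgeRate G i j ≤ 1 :=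
  calc ∑ j ∈ G.neighborFinset i, edgeRate G i j
      ≤ ∑ _j ∈ G.neighborFinset i, (G.degree i : ℝ)⁻¹ :=
        Finset.sum_le_sum fun j _ => edgeRate_le_inv_degree G i j
    _ ≤ 1 := by
        rw [Finset.sum_const, G.card_neighborFinset_eq_degree, nsmul_eq_mul]
        exact mul_inv_le_one

lemma clockRate_nonneg (e : Sym2 (Fin n)) : 0 ≤ clockRate G e := by
  induction e with | _ i j =>
  change 0 ≤ if i = j then loopRate G i else edgeRate G i j
  split_ifs
  · unfold loopRate
    linarith [sum_edgeRate_le_one G i]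
  · exact edgeRate_nonneg G i j

lemma clockRate_le_one (e : Sym2 (Fin n)) : clockRate G e ≤ 1 := by
  induction e with | _ i j =>
  change (if i = j then loopRate G i else edgeRate G i j) ≤ 1
  split_ifs
  · unfold loopRate
    exact sub_le_self _ (mul_nonneg (by norm_num)
      (Finset.sum_nonneg fun j _ => edgeRate_nonneg G i j))
  · exact (edgeRate_le_inv_degree G i j).trans (Nat.cast_inv_le_one _)

end ClockRates

section PoissonCounts

variable {E Ω : Type*} [Fintype E] [MeasurableSpace Ω] {P : Measure Ω} {Z : Ω → E → ℕ}
  {r : E → ℝ≥0}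

lemma measureReal_poisson_eq (hind : iIndepFun (fun e ω => Z ω e) P)
    (hlaw : ∀ e, HasLaw (fun ω => Z ω e) (poissonMeasure (r e)) P) (v : E → ℕ) :
    P.real {ω | Z ω = v} =
      ∏ e, Real.exp (-(r e : ℝ)) * (r e : ℝ) ^ v e / (v e).factorial := by
  have eq_iInter : {ω | Z ω = v} = ⋂ e ∈ Finset.univ, (fun ω => Z ω e) ⁻¹' {v e} := by
    ext ω
    simp [funext_iff]
  rw [eq_iInter, measureReal_def, hind.measure_inter_preimage_eq_mul Finset.univ
    (sets := fun e => {v e}) fun e _ => MeasurableSet.singleton _, ENNReal.toReal_prod]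
  refine Finset.prod_congr rfl fun e _ => ?_
  rw [← poissonMeasure_real_singleton]
  exact (hlaw e).measureReal_eq (p := fun k => k = v e) (MeasurableSet.singleton _)

lemma measureReal_poisson_zero (hind : iIndepFun (fun e ω => Z ω e) P)
    (hlaw : ∀ e, HasLaw (fun ω => Z ω e) (poissonMeasure (r e)) P) :
    P.real {ω | Z ω = 0} = Real.exp (-∑ e, (r e : ℝ)) := by
  rw [measureReal_poisson_eq hind hlaw, ← Finset.sum_neg_distrib, Real.exp_sum]
  simp

variable [DecidableEq E]

lemma measureReal_poisson_single (hind : iIndepFun (fun e ω => Z ω e) P)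
    (hlaw : ∀ e, HasLaw (fun ω => Z ω e) (poissonMeasure (r e)) P) (e : E) :
    P.real {ω | Z ω = Pi.single e 1} = r e * Real.exp (-∑ e, (r e : ℝ)) := by
  rw [measureReal_poisson_eq hind hlaw, ← Finset.sum_neg_distrib, Real.exp_sum]
  simp_rw [mul_div_assoc]
  rw [Finset.prod_mul_distrib, mul_comm]
  congr 1
  rw [Finset.prod_eq_single e]
  · simp
  · intro e' _ he'
    simp [Pi.single_eq_of_ne he']
  · simp

lemma measureReal_poisson_several_le (hZ : Measurable Z) (hind : iIndepFun (fun e ω => Z ω e) P)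
    (hlaw : ∀ e, HasLaw (fun ω => Z ω e) (poissonMeasure (r e)) P) :
    P.real {ω | ¬ (Z ω = 0 ∨ ∃ e, Z ω = Pi.single e 1)} ≤ (∑ e, (r e : ℝ)) ^ 2 := by
  have := hind.isProbabilityMeasure
  let few : Finset (E → ℕ) := insert 0 (Finset.univ.image fun e => Pi.single e 1)
  have eq_compl : {ω | ¬ (Z ω = 0 ∨ ∃ e, Z ω = Pi.single e 1)} = (Z ⁻¹' few)ᶜ := by
    ext ω
    simp [few, eq_comm]
  have measureReal_few : P.real (Z ⁻¹' few) =
      (1 + ∑ e, (r e : ℝ)) * Real.exp (-∑ e, (r e : ℝ)) := by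
    rw [← sum_measureReal_preimage_singleton few fun v _ => hZ (MeasurableSet.singleton v),
      Finset.sum_insert (by simp), Finset.sum_image fun e _ e' _ h => single_one_injective h,
      add_mul, one_mul, Finset.sum_mul]
    exact congrArg₂ _ (measureReal_poisson_zero hind hlaw)
      (Finset.sum_congr rfl fun e _ => measureReal_poisson_single hind hlaw e)
  rw [eq_compl, probReal_compl_eq_one_sub (hZ few.measurableSet), measureReal_few]
  nlinarith [Real.one_sub_le_exp_neg (∑ e, (r e : ℝ)),
    Finset.sum_nonneg fun e (_ : e ∈ Finset.univ) => (r e).coe_nonneg]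

end PoissonCounts

section Cells

variable {n : ℕ} {Ω : Type*} {N : Sym2 (Fin n) → ℝ≥0 → Ω → ℕ} {K j : ℕ}

/-- The `j`-th time of the grid of mesh `1 / K`. -/
def gridTime (K j : ℕ) : ℝ≥0 := (j : ℝ≥0) / K

lemma gridTime_mono (K : ℕ) : Monotone (gridTime K) := by
  intro i j hij
  unfold gridTime
  gcongr

/-- The numbers of arrivals in the `j`-th cell of the grid of mesh `1 / K`. -/
def cellCount (N : Sym2 (Fin n) → ℝ≥0 → Ω → ℕ) (K j : ℕ) (ω : Ω) (e : Sym2 (Fin n)) : ℕ :=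
  N e (gridTime K (j + 1)) ω - N e (gridTime K j) ω

lemma IsDrivenPath.eq_traj {ω : Ω} {x₀ : Fin n → ℤ} {x : ℝ≥0 → Fin n → ℤ}
    (hx : IsDrivenPath (fun e t => N e t ω) x₀ x) (hN : ∀ e, Monotone fun t => N e t ω)
    (hfew : ∀ i < j, cellCount N K i ω = 0 ∨ ∃ e, cellCount N K i ω = Pi.single e 1) :
    x (gridTime K j) = traj update x₀ (fun i => cellCount N K i ω) j := by
  induction j with
  | zero => simpa [gridTime, traj] using hx.initial
  | succ j ih =>
    have grid_le := gridTime_mono K j.le_succ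
    have eq_add (e : Sym2 (Fin n)) :
        N e (gridTime K (j + 1)) ω = N e (gridTime K j) ω + cellCount N K j ω e :=
      (Nat.add_sub_of_le (hN e grid_le)).symm
    rw [traj, ← ih fun i hi => hfew i (hi.trans j.lt_succ_self)]
    rcases hfew j j.lt_succ_self with hzero | ⟨e, he⟩
    · rw [hzero, fire_of_forall_ne fun e h => by simpa using congrFun h e]
      exact hx.no_arrival _ _ grid_le fun e => by rw [eq_add, hzero, Pi.zero_apply, add_zero]
    · rw [he, fire_single]
      refine hx.one_arrival _ _ e grid_le ?_ fun e' hne => ?_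
      · rw [eq_add, he, Pi.single_eq_same]
      · rw [eq_add, he, Pi.single_eq_of_ne hne, add_zero]

variable {G : ℕ → SimpleGraph (Fin n)}

lemma natFloor_eq_of_mem_cell (hK : 0 < K) {u : ℝ} (hu : j / K ≤ u) (hu' : u < (j + 1) / K) :
    ⌊u⌋₊ = j / K := by
  have hK' : (0 : ℝ) < K := by exact_mod_cast hK
  rw [Nat.floor_eq_iff (le_trans (by positivity) hu)]
  refine ⟨Nat.cast_div_le.trans hu, hu'.trans_le ?_⟩
  rw [div_le_iff₀ hK']
  have : j + 1 ≤ (j / K + 1) * K := by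
    rw [Nat.add_one_le_iff, mul_comm]
    exact Nat.lt_mul_div_succ j hK
  exact_mod_cast this

lemma integral_cell (hK : 0 < K) (rate : ℕ → ℝ) :
    ∫ u in (gridTime K j : ℝ)..(gridTime K (j + 1) : ℝ), rate ⌊u⌋₊ = rate (j / K) / K := by
  have coe_left : (gridTime K j : ℝ) = j / K := by simp [gridTime]
  have coe_right : (gridTime K (j + 1) : ℝ) = (j + 1) / K := by simp [gridTime]
  have cell_le : (j : ℝ) / K ≤ (j + 1) / K := by
    gcongr
    exact le_add_of_nonneg_right zero_le_one
  have const_on_cell : ∫ u in ((j : ℝ) / K)..((j + 1 : ℝ) / K), rate ⌊u⌋₊ =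
      ∫ _ in ((j : ℝ) / K)..((j + 1 : ℝ) / K), rate (j / K) := by
    refine intervalIntegral.integral_congr_ae ?_
    filter_upwards [Measure.ae_ne volume ((j + 1 : ℝ) / K)] with u hne hu
    rw [Set.uIoc_of_le cell_le] at hu
    rw [natFloor_eq_of_mem_cell hK hu.1.le (hu.2.lt_of_ne hne)]
  rw [coe_left, coe_right, const_on_cell, intervalIntegral.integral_const, smul_eq_mul]
  ring

/-- The expected number of arrivals at `e` in the `j`-th cell of the grid of mesh `1 / K`. -/
def cellRate (G : ℕ → SimpleGraph (Fin n)) (K j : ℕ) (e : Sym2 (Fin n)) : ℝ≥0 :=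
  Real.toNNReal (clockRate (G (j / K)) e / K)

lemma coe_cellRate (e : Sym2 (Fin n)) :
    (cellRate G K j e : ℝ) = clockRate (G (j / K)) e / K :=
  Real.coe_toNNReal _ (div_nonneg (clockRate_nonneg _ e) K.cast_nonneg)

lemma sum_cellRate_le :
    ∑ e, (cellRate G K j e : ℝ) ≤ Fintype.card (Sym2 (Fin n)) / K := by
  simp only [coe_cellRate]
  rw [← Finset.sum_div]
  gcongr
  simpa using Finset.sum_le_sum fun e (_ : e ∈ Finset.univ) => clockRate_le_one (G (j / K)) e

variable [MeasurableSpace Ω] {P : Measure Ω}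

namespace AreMetropolisClocks

lemma measurable_cellCount (hN : AreMetropolisClocks P G N) (K j : ℕ) (e : Sym2 (Fin n)) :
    Measurable fun ω => cellCount N K j ω e :=
  ((hN.poisson e).measurable _).sub ((hN.poisson e).measurable _)

lemma iIndepFun_cellCount (hN : AreMetropolisClocks P G N) (K : ℕ) :
    iIndepFun (fun (q : Sym2 (Fin n) × ℕ) ω => cellCount N K q.2 ω q.1) P := by
  refine iIndepFun_uncurry' (X := fun e j ω => cellCount N K j ω e)
    (fun e j => hN.measurable_cellCount K j e) ?_ fun e => ?_
  · exact hN.indep.comp (fun _ path j => path (gridTime K (j + 1)) - path (gridTime K j))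
      fun _ => measurable_pi_lambda _ fun _ => (measurable_pi_apply _).sub (measurable_pi_apply _)
  · exact (hN.poisson e).indep_increments.nat (gridTime_mono K)

lemma iIndepFun_cellCount_apply (hN : AreMetropolisClocks P G N) (K j : ℕ) :
    iIndepFun (fun e ω => cellCount N K j ω e) P :=
  (hN.iIndepFun_cellCount K).precomp (g := fun e => (e, j)) fun _ _ h => (Prod.ext_iff.1 h).1

lemma hasLaw_cellCount (hN : AreMetropolisClocks P G N) (hK : 0 < K) (j : ℕ)
    (e : Sym2 (Fin n)) :
    HasLaw (fun ω => cellCount N K j ω e) (poissonMeasure (cellRate G K j e)) P := by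
  have := (hN.poisson e).law_increments _ _ (gridTime_mono K j.le_succ)
  rwa [integral_cell hK fun k => clockRate (G k) e] at this

lemma isLazyActivation (hN : AreMetropolisClocks P G N) (hG : ∀ k, (G k).Connected) (hK : 0 < K)
    (hcard : 2 * Fintype.card (Sym2 (Fin n)) ≤ K) (j : ℕ) :
    IsLazyActivation (fun e => P.real {ω | cellCount N K j ω = Pi.single e 1})
      (12 * n * K) := by
  classical
  have hK' : (0 : ℝ) < K := by exact_mod_cast hK
  have single_eq (e : Sym2 (Fin n)) : P.real {ω | cellCount N K j ω = Pi.single e 1} =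
      cellRate G K j e * Real.exp (-∑ e, (cellRate G K j e : ℝ)) :=
    measureReal_poisson_single (hN.iIndepFun_cellCount_apply K j) (hN.hasLaw_cellCount hK j) e
  set mass : ℝ := ∑ e, (cellRate G K j e : ℝ) with mass_def
  have mass_nonneg : 0 ≤ mass := Finset.sum_nonneg fun _ _ => NNReal.coe_nonneg _
  have mass_le : mass ≤ 1 / 2 := by
    refine sum_cellRate_le.trans ?_
    rw [div_le_iff₀ hK']
    have : (2 * Fintype.card (Sym2 (Fin n)) : ℝ) ≤ K := by exact_mod_cast hcard
    linarith
  refine ⟨fun e => measureReal_nonneg, ?_, ?_⟩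
  · simp only [single_eq]
    rw [← Finset.sum_mul, ← mass_def]
    exact (mul_le_of_le_one_right mass_nonneg (Real.exp_le_one_iff.2 (by linarith))).trans mass_le
  · have half_le_exp : 1 / 2 ≤ Real.exp (-mass) := by
      linarith [Real.one_sub_le_exp_neg mass]
    have resistance := hasResistanceLE_of_metropolis (hG (j / K)) (κ := 1 / (2 * K))
      (c := fun e => P.real {ω | cellCount N K j ω = Pi.single e 1})
      (fun e => measureReal_nonneg) (by positivity) fun a b hab => by
        rw [single_eq, coe_cellRate, clockRate_adj hab]
        calc 1 / (2 * K) / (max ((G (j / K)).degree a) ((G (j / K)).degree b) : ℝ)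
            = 1 / (max ((G (j / K)).degree a) ((G (j / K)).degree b) : ℝ) / K * (1 / 2) := by
              ring
          _ ≤ _ := by gcongr
    convert resistance using 1
    rw [Fintype.card_fin]
    field_simp
    ring

lemma measureReal_several_le (hN : AreMetropolisClocks P G N) (hK : 0 < K) (j : ℕ) :
    P.real {ω | ¬ (cellCount N K j ω = 0 ∨ ∃ e, cellCount N K j ω = Pi.single e 1)} ≤
      (Fintype.card (Sym2 (Fin n)) / K : ℝ) ^ 2 :=
  (measureReal_poisson_several_le (measurable_pi_lambda _ (hN.measurable_cellCount K j))
    (hN.iIndepFun_cellCount_apply K j) (hN.hasLaw_cellCount hK j)).trans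
    (pow_le_pow_left₀ (Finset.sum_nonneg fun _ _ => NNReal.coe_nonneg _) sum_cellRate_le 2)

end AreMetropolisClocks

end Cells

section HittingTime

variable {n : ℕ} {Ω : Type*} {τ K : ℕ}

lemma hittingTime_le_tsum (x : ℝ≥0 → Fin n → ℤ) (S : Set (Fin n → ℤ)) (hτ : 0 < τ) :
    hittingTime x S ≤ ∑' i : ℕ, τ * ({i : ℕ | x (i * τ) ∉ S}.indicator 1 i : ℝ≥0∞) := by
  classical
  by_cases hits : ∃ i : ℕ, x (i * τ) ∈ S
  · calc hittingTime x S ≤ ((Nat.find hits * τ : ℝ≥0) : ℝ≥0∞) :=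
          iInf₂_le (Nat.find hits * τ : ℝ≥0) (Nat.find_spec hits)
      _ = ∑ _i ∈ Finset.range (Nat.find hits), (τ : ℝ≥0∞) := by simp
      _ = ∑ i ∈ Finset.range (Nat.find hits),
            τ * ({i : ℕ | x (i * τ) ∉ S}.indicator 1 i : ℝ≥0∞) := by
        refine Finset.sum_congr rfl fun i hi => ?_
        rw [Set.indicator_of_mem (Nat.find_min hits (Finset.mem_range.1 hi)), Pi.one_apply, mul_one]
      _ ≤ _ := ENNReal.sum_le_tsum _
  · have misses (i : ℕ) : i ∈ {i : ℕ | x (i * τ) ∉ S} := fun hi => hits ⟨i, hi⟩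
    simp only [Set.indicator_of_mem (misses _), Pi.one_apply, mul_one]
    rw [ENNReal.tsum_const_eq_top_of_ne_zero (by exact_mod_cast hτ.ne')]
    exact le_top

variable [MeasurableSpace Ω] {P : Measure Ω} {G : ℕ → SimpleGraph (Fin n)}
  {N : Sym2 (Fin n) → ℝ≥0 → Ω → ℕ} {x₀ : Fin n → ℤ} {X : ℝ≥0 → Ω → Fin n → ℤ}

namespace IsQuantizedMetropolis

lemma ae_notMem_consensusSet_imp [NeZero n] (hX : IsQuantizedMetropolis P G N x₀ X) (K j : ℕ) :
    ∀ᵐ ω ∂P, X (gridTime K j) ω ∉ consensusSet x₀ →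
      traj update x₀ (fun i => cellCount N K i ω) j ∈ wideStates n ∨
        ∃ i < j, ¬ (cellCount N K i ω = 0 ∨ ∃ e, cellCount N K i ω = Pi.single e 1) := by
  have monotone_paths : ∀ᵐ ω ∂P, ∀ e, Monotone fun t => N e t ω :=
    ae_all_iff.2 fun e => (hX.clocks.poisson e).path.mono fun _ h => h.2.1
  filter_upwards [monotone_paths, hX.driven] with ω hmono hdriven hmem
  by_contra! hcon
  have sum_traj := traj_mem (move := update) (B := {y | ∑ i, y i = ∑ i, x₀ i}) rfl
    (fun e y hy => (sum_update e y).trans hy) (fun i => cellCount N K i ω) j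
  refine hmem ?_
  rw [hdriven.eq_traj hmono hcon.2]
  exact mem_consensusSet sum_traj hcon.1

lemma measureReal_notMem_consensusSet_le [IsProbabilityMeasure P] [NeZero n]
    (hX : IsQuantizedMetropolis P G N x₀ X) (hK : 0 < K) (j : ℕ) :
    P.real {ω | X (gridTime K j) ω ∉ consensusSet x₀} ≤
      evolve update (fun i e => P.real {ω | cellCount N K i ω = Pi.single e 1}) j
          ((wideStates n).indicator 1) x₀ +
        j * (Fintype.card (Sym2 (Fin n)) / K : ℝ) ^ 2 := by
  set wide : Set Ω := {ω | traj update x₀ (fun i => cellCount N K i ω) j ∈ wideStates n}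
  set several : ℕ → Set Ω := fun i =>
    {ω | ¬ (cellCount N K i ω = 0 ∨ ∃ e, cellCount N K i ω = Pi.single e 1)}
  have measurable_count := hX.clocks.measurable_cellCount K
  have measurable_wide : MeasurableSet wide :=
    measurable_traj x₀ (fun i => measurable_pi_lambda _ (measurable_count i)) j
      (Set.to_countable (wideStates n)).measurableSet
  have measureReal_wide : P.real wide =
      evolve update (fun i e => P.real {ω | cellCount N K i ω = Pi.single e 1}) j
        ((wideStates n).indicator 1) x₀ := by
    rw [← integral_traj measurable_count (hX.clocks.iIndepFun_cellCount K) x₀ j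
      ⟨1, fun y => (norm_indicator_le_norm_self _ _).trans (by simp)⟩,
      ← integral_indicator_one measurable_wide]
    rfl
  have measureReal_several : P.real (⋃ i ∈ Finset.range j, several i) ≤
      j * (Fintype.card (Sym2 (Fin n)) / K : ℝ) ^ 2 :=
    calc _ ≤ ∑ i ∈ Finset.range j, P.real (several i) := measureReal_biUnion_finset_le _ _
      _ ≤ ∑ _i ∈ Finset.range j, (Fintype.card (Sym2 (Fin n)) / K : ℝ) ^ 2 :=
        Finset.sum_le_sum fun i _ => hX.clocks.measureReal_several_le hK i
      _ = _ := by simp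
  have ae_subset : {ω | X (gridTime K j) ω ∉ consensusSet x₀} ≤ᵐ[P]
      (wide ∪ ⋃ i ∈ Finset.range j, several i : Set Ω) := by
    filter_upwards [hX.ae_notMem_consensusSet_imp K j] with ω himp hmem
    refine (himp hmem).imp id fun ⟨i, hi, hsev⟩ => ?_
    exact Set.mem_iUnion₂.2 ⟨i, Finset.mem_range.2 hi, hsev⟩
  calc P.real {ω | X (gridTime K j) ω ∉ consensusSet x₀}
      ≤ P.real (wide ∪ ⋃ i ∈ Finset.range j, several i) :=
        ENNReal.toReal_mono (measure_ne_top _ _) (measure_mono_ae ae_subset)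
    _ ≤ P.real wide + P.real (⋃ i ∈ Finset.range j, several i) := measureReal_union_le _ _
    _ ≤ _ := add_le_add measureReal_wide.le measureReal_several

variable [IsProbabilityMeasure P]

lemma sum_measureReal_notMem_le (hX : IsQuantizedMetropolis P G N x₀ X)
    (hG : ∀ k, (G k).Connected)
    (hτ : 48 * (n : ℝ) ^ 2 * Real.log (2 * (n : ℝ) ^ 2) ≤ τ) (r : ℕ) :
    ∑ i ∈ Finset.range r, P.real {ω | X (i * τ) ω ∉ consensusSet x₀} ≤ 2 * excess x₀ := by
  have : NeZero n := ⟨(Fin.pos_iff_nonempty.2 (hG 0).nonempty).ne'⟩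
  set B := (Fintype.card (Sym2 (Fin n)) : ℝ)
  set error : ℝ := ∑ i ∈ Finset.range r, (i * τ * B ^ 2 : ℝ)
  suffices discretized : ∀ᶠ K : ℕ in Filter.atTop,
      ∑ i ∈ Finset.range r, P.real {ω | X (i * τ) ω ∉ consensusSet x₀} ≤
        2 * excess x₀ + error / K by
    refine ge_of_tendsto ?_ discretized
    simpa using (tendsto_const_div_atTop_nhds_zero_nat error).const_add (2 * excess x₀)
  filter_upwards [Filter.eventually_ge_atTop (2 * Fintype.card (Sym2 (Fin n))),
    Filter.eventually_gt_atTop 0] with K hcard hK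
  have hK' : (0 : ℝ) < K := by exact_mod_cast hK
  have sum_evolve_le := sum_evolve_wideStates_le (n := n) (k := τ * K) (R := 12 * n * K)
    (have := NeZero.pos n; by positivity) (hX.clocks.isLazyActivation hG hK hcard)
    (by push_cast; nlinarith [mul_le_mul_of_nonneg_right hτ hK'.le]) x₀ r
  have grid_eq (i : ℕ) : gridTime K (i * (τ * K)) = i * τ := by
    unfold gridTime
    push_cast
    field_simp
  refine (Finset.sum_le_sum fun i _ => grid_eq i ▸
    hX.measureReal_notMem_consensusSet_le hK (i * (τ * K))).trans ?_
  rw [Finset.sum_add_distrib, Finset.sum_div]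
  refine add_le_add sum_evolve_le (Finset.sum_le_sum fun i _ => le_of_eq ?_)
  push_cast
  field_simp
  rfl

theorem lintegral_hittingTime_le (hX : IsQuantizedMetropolis P G N x₀ X)
    (hG : ∀ k, (G k).Connected) (hτ0 : 0 < τ)
    (hτ : 48 * (n : ℝ) ^ 2 * Real.log (2 * (n : ℝ) ^ 2) ≤ τ) :
    ∫⁻ ω, hittingTime (fun t => X t ω) (consensusSet x₀) ∂P ≤
      ENNReal.ofReal (τ * (2 * excess x₀)) := by
  set miss : ℕ → Set Ω := fun i => {ω | X (i * τ) ω ∉ consensusSet x₀}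
  have measurable_miss (i : ℕ) : MeasurableSet (miss i) :=
    hX.measurable _ (Set.to_countable (consensusSet x₀)ᶜ).measurableSet
  have tsum_miss_le : ∑' i, P (miss i) ≤ ENNReal.ofReal (2 * excess x₀) := by
    refine ENNReal.tsum_le_of_sum_range_le fun r => ?_
    rw [← Finset.sum_congr rfl fun i _ => ofReal_measureReal (μ := P) (s := miss i),
      ← ENNReal.ofReal_sum_of_nonneg fun i _ => measureReal_nonneg]
    exact ENNReal.ofReal_le_ofReal (hX.sum_measureReal_notMem_le hG hτ r)
  calc _ ≤ ∫⁻ ω, ∑' i : ℕ, τ * (miss i).indicator 1 ω ∂P :=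
        lintegral_mono fun ω => hittingTime_le_tsum _ _ hτ0
    _ = ∑' i, τ * P (miss i) := by
      rw [lintegral_tsum fun i =>
        ((measurable_one.indicator (measurable_miss i)).const_mul _).aemeasurable]
      refine tsum_congr fun i => ?_
      rw [lintegral_const_mul _ (measurable_one.indicator (measurable_miss i)),
        lintegral_indicator_one (measurable_miss i)]
    _ ≤ _ := by
      rw [ENNReal.tsum_mul_left, ENNReal.ofReal_mul (by positivity), ENNReal.ofReal_natCast]
      gcongr

end IsQuantizedMetropolis

lemma ceil_le_mul_log (hn : 2 ≤ n) :
    (⌈48 * (n : ℝ) ^ 2 * Real.log (2 * (n : ℝ) ^ 2)⌉₊ : ℝ) ≤ 150 * n ^ 2 * Real.log n := by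
  have hn' : (2 : ℝ) ≤ n := by exact_mod_cast hn
  have log_two_le : Real.log 2 ≤ Real.log n := Real.log_le_log (by norm_num) hn'
  have log_le : Real.log (2 * (n : ℝ) ^ 2) ≤ 3 * Real.log n := by
    rw [Real.log_mul (by norm_num) (by positivity), Real.log_pow]
    push_cast
    linarith
  have one_le : (1 : ℝ) ≤ n ^ 2 * Real.log n := by
    nlinarith [Real.log_two_gt_d9]
  have log_nonneg : 0 ≤ Real.log (2 * (n : ℝ) ^ 2) := Real.log_nonneg (by nlinarith)
  calc (⌈48 * (n : ℝ) ^ 2 * Real.log (2 * (n : ℝ) ^ 2)⌉₊ : ℝ)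
      ≤ 48 * (n : ℝ) ^ 2 * Real.log (2 * (n : ℝ) ^ 2) + 1 :=
        (Nat.ceil_lt_add_one (by positivity)).le
    _ ≤ 48 * (n : ℝ) ^ 2 * (3 * Real.log n) + n ^ 2 * Real.log n := by gcongr
    _ ≤ 150 * n ^ 2 * Real.log n := by linarith

lemma log_natCast_le_two_mul_sq_log (n : ℕ) : Real.log n ≤ 2 * Real.log n ^ 2 := by
  rcases Nat.lt_or_ge n 2 with hn | hn
  · interval_cases n <;> simp
  · have : Real.log 2 ≤ Real.log n := Real.log_le_log (by norm_num) (by exact_mod_cast hn)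
    nlinarith [Real.log_two_gt_d9]

end HittingTime

end

end QuantizedMetropolis

theorem mainTheorem1_general {n : ℕ} {G : ℕ → SimpleGraph (Fin n)} (hG : ∀ k, (G k).Connected)
    {x₀ : Fin n → ℤ} {Ω : Type*} [MeasurableSpace Ω] {P : Measure Ω} [IsProbabilityMeasure P]
    {N : Sym2 (Fin n) → ℝ≥0 → Ω → ℕ} {X : ℝ≥0 → Ω → Fin n → ℤ}
    (hX : QuantizedMetropolis.IsQuantizedMetropolis P G N x₀ X) :
    ∫⁻ ω, QuantizedMetropolis.hittingTime (fun t => X t ω)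
        (QuantizedMetropolis.consensusSet x₀) ∂P
      ≤ ENNReal.ofReal (300 * QuantizedMetropolis.excess x₀ * (n : ℝ) ^ 2 * Real.log n) := by
  have hn : 0 < n := Fin.pos_iff_nonempty.2 (hG 0).nonempty
  have one_le_n : (1 : ℝ) ≤ n := by exact_mod_cast hn
  have log_pos : 0 < Real.log (2 * (n : ℝ) ^ 2) := Real.log_pos (by nlinarith)
  refine (hX.lintegral_hittingTime_le hG (Nat.ceil_pos.2 (by positivity)) (Nat.le_ceil _)).trans
    (ENNReal.ofReal_le_ofReal ?_)
  obtain rfl | two_le : n = 1 ∨ 2 ≤ n := by omega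
  · simp [QuantizedMetropolis.excess, QuantizedMetropolis.spread]
  · have excess_nonneg : 0 ≤ QuantizedMetropolis.excess x₀ := QuantizedMetropolis.excess_nonneg x₀
    calc _ ≤ 150 * (n : ℝ) ^ 2 * Real.log n * (2 * QuantizedMetropolis.excess x₀) :=
          mul_le_mul_of_nonneg_right (QuantizedMetropolis.ceil_le_mul_log two_le) (by positivity)
      _ = _ := by ring

theorem mainTheorem1 :
    ∃ C : ℝ, 0 < C ∧
      ∀ (n : ℕ) (G : ℕ → SimpleGraph (Fin n)), (∀ k, (G k).Connected) →
      ∀ (l L : ℤ) (x₀ : Fin n → ℤ), (∀ i, l ≤ x₀ i ∧ x₀ i ≤ L) →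
      ∀ (Ω : Type*) [MeasurableSpace Ω] (P : Measure Ω) [IsProbabilityMeasure P]
        (N : Sym2 (Fin n) → ℝ≥0 → Ω → ℕ) (X : ℝ≥0 → Ω → Fin n → ℤ),
        QuantizedMetropolis.IsQuantizedMetropolis P G N x₀ X →
        ∫⁻ ω, QuantizedMetropolis.hittingTime (fun t => X t ω)
            (QuantizedMetropolis.consensusSet x₀) ∂P
          ≤ ENNReal.ofReal (C * ((L : ℝ) - (l : ℝ)) * (n : ℝ) ^ 2 * Real.log n ^ 2) := by
  refine ⟨600, by norm_num, fun n G hG l L x₀ hx₀ Ω _ P _ N X hX => ?_⟩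
  have : NeZero n := ⟨(Fin.pos_iff_nonempty.2 (hG 0).nonempty).ne'⟩
  have excess_le : QuantizedMetropolis.excess x₀ ≤ L - l := QuantizedMetropolis.excess_le hx₀
  have range_nonneg : (0 : ℝ) ≤ L - l := (QuantizedMetropolis.excess_nonneg x₀).trans excess_le
  refine (mainTheorem1_general hG hX).trans (ENNReal.ofReal_le_ofReal ?_)
  calc 300 * QuantizedMetropolis.excess x₀ * (n : ℝ) ^ 2 * Real.log n
      ≤ 300 * ((L : ℝ) - l) * (n : ℝ) ^ 2 * (2 * Real.log n ^ 2) := by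
        gcongr
        exact QuantizedMetropolis.log_natCast_le_two_mul_sq_log n
    _ = _ := by ring
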